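/- **Setting.** Let $\Omega\subset\mathbb R^3$ be a bounded domain with smooth boundary, and let $D$ be a nonempty open set with $\overline D\subset\Omega$, $\Omega\setminus\overline D$ connected and $\partial D$ Lipschitz. Let $V_0\in L^\infty(\Omega)$ and $\lambda\in L^\infty(\partial D)$ be complex valued. All functions below are complex valued, $a\cdot b=\sum_j a_jb_j$ is the bilinear product on $\mathbb C^3$, $dS$ is surface measure, and $\nu$ is the unit normal pointing out of $\Omega$ on $\partial\Omega$ and out of $D$ on $\partial D$. Let $v\in H^1(\Omega)$ be a weak solution of $\Delta v+V_0v=0$ in $\Omega$, that is, $$-\int_\Omega\nabla v\cdot\nabla\psi\,dx+\int_\Omega V_0v\psi\,dx=0$$ for all $\psi\in H^1(\Omega)$ with zero trace on $\partial\Omega$. Let $u\in H^1(\Omega\setminus\overline D)$ be a weak solution of $\Delta u+V_0u=0$ in $\Omega\setminus\overline D$, $\partial u/\partial\nu+\lambda u=0$ on $\partial D$, $u=v$ on $\partial\Omega$; that is, $u=v$ on $\partial\Omega$ in the sense of traces and $$\int_{\partial D}\lambda u\varphi\,dS-\int_{\Omega\setminus\overline D}\nabla u\cdot\nabla\varphi\,dx+\int_{\Omega\setminus\overline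 D}V_0u\varphi\,dx=0$$ for all $\varphi\in H^1(\Omega\setminus\overline D)$ with zero trace on $\partial\Omega$. For $f\in H^{1/2}(\partial\Omega)$ the normal derivatives on $\partial\Omega$ are the functionals $$\Big\langle\frac{\partial v}{\partial\nu}\Big|_{\partial\Omega},f\Big\rangle=\int_\Omega\nabla v\cdot\nabla\eta\,dx-\int_\Omega V_0v\eta\,dx,$$ $$\Big\langle\frac{\partial u}{\partial\nu}\Big|_{\partial\Omega},f\Big\rangle=-\int_{\partial D}\lambda u\phi\,dS+\int_{\Omega\setminus\overline D}\nabla u\cdot\nabla\phi\,dx-\int_{\Omega\setminus\overline D}V_0u\phi\,dx,$$ where $\eta\in H^1(\Omega)$ and $\phi\in H^1(\Omega\setminus\overline D)$ are arbitrary with trace $f$ on $\partial\Omega$ (the values do not depend on the choice). **Proposition 1.1.** Let $w=u-v$ in $\Omega\setminus\overline D$. Then $$\begin{aligned} \Big\langle\frac{\partial v}{\partial\nu}\Big|_{\partial\Omega}-\frac{\partial u}{\partial\nu}\Big|_{\partial\Omega},\ \overline v|_{\partial\Omega}\Big\rangle ={}&2i\int_{\partial D}\operatorname{Im}(\lambda)\,w\,\overline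 v\,dS+2i\int_{\Omega\setminus\overline D}\operatorname{Im}(V_0)\,w\,\overline v\,dx\\ &-\int_{\partial D}\overline{\lambda}\,|w|^2\,dS+\int_{\Omega\setminus\overline D}|\nabla w|^2\,dx-\int_{\Omega\setminus\overline D}\overline{V_0}\,|w|^2\,dx\\ &+\int_{\partial D}\lambda\,|v|^2\,dS+\int_D|\nabla v|^2\,dx-\int_DV_0\,|v|^2\,dx . \end{aligned}$$ -/

import Mathlib

open MeasureTheory Set Filter Topology
open scoped ContDiff ENNReal ComplexConjugate

noncomputable section

namespace ObstacleProblem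

/-- Physical space `ℝ³` with its Euclidean norm. -/
abbrev R3 : Type := EuclideanSpace ℝ (Fin 3)

/-- The `i`-th standard basis vector of `ℝ³`. -/
def basisVec (i : Fin 3) : R3 := EuclideanSpace.single i (1 : ℝ)

/-! ### Boundary regularity -/

/-- `U` is locally, near each of its boundary points and after a rigid motion, the region lying
below the graph of a function of two variables of the class `P`. -/
def HasGraphBoundary (P : (EuclideanSpace ℝ (Fin 2) → ℝ) → Prop) (U : Set R3) : Prop :=
  ∀ x ∈ frontier U, ∃ (e : R3 ≃ᵃⁱ[ℝ] R3) (g : EuclideanSpace ℝ (Fin 2) → ℝ) (r : ℝ),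
    P g ∧ 0 < r ∧ ∀ y ∈ Metric.ball x r, (y ∈ U ↔ (e y) 2 < g !₂[(e y) 0, (e y) 1])

/-- The boundary of `U` is smooth (of class `C^∞`). -/
def HasSmoothBoundary (U : Set R3) : Prop :=
  HasGraphBoundary (fun g => ContDiff ℝ ∞ g) U

/-- The boundary of `U` is Lipschitz. -/
def HasLipschitzBoundary (U : Set R3) : Prop :=
  HasGraphBoundary (fun g => ∃ K, LipschitzWith K g) U

/-- The surface measure `dS` on `Γ ⊆ ℝ³`: the two-dimensional Hausdorff measure, normalised so that
it is the area on planes, restricted to `Γ`. -/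
def surfaceMeasure (Γ : Set R3) : Measure R3 :=
  (Measure.euclideanHausdorffMeasure 2 : Measure R3).restrict Γ

/-! ### The Sobolev space `H¹` of complex valued functions

A function on an open set `U` is given by a function on `ℝ³` of which only the values in `U`
matter. -/

/-- `G` is the weak (distributional) gradient of `f` in the open set `U`. -/
def IsWeakGrad (U : Set R3) (f : R3 → ℂ) (G : R3 → EuclideanSpace ℂ (Fin 3)) : Prop :=
  ∀ (i : Fin 3) (φ : R3 → ℝ), ContDiff ℝ ∞ φ → HasCompactSupport φ → tsupport φ ⊆ U →
    ∫ x in U, f x * ((fderiv ℝ φ x (basisVec i) : ℝ) : ℂ) = -∫ x in U, G x i * (φ x : ℂ)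

/-- `f ∈ H¹(U)`: both `f` and its weak gradient are square integrable in `U`. -/
def MemH1 (U : Set R3) (f : R3 → ℂ) : Prop :=
  MemLp f 2 (volume.restrict U) ∧
    ∃ G : R3 → EuclideanSpace ℂ (Fin 3), MemLp G 2 (volume.restrict U) ∧ IsWeakGrad U f G

open Classical in
/-- The weak gradient of `f ∈ H¹(U)` (unique almost everywhere in `U`). -/
def weakGrad (U : Set R3) (f : R3 → ℂ) : R3 → EuclideanSpace ℂ (Fin 3) :=
  if h : ∃ G : R3 → EuclideanSpace ℂ (Fin 3),
      MemLp G 2 (volume.restrict U) ∧ IsWeakGrad U f G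
  then h.choose else 0

/-- The classical gradient of a differentiable complex valued function. -/
def classicalGrad (φ : R3 → ℂ) (x : R3) : EuclideanSpace ℂ (Fin 3) :=
  WithLp.toLp 2 fun i => fderiv ℝ φ x (basisVec i)

/-- The bilinear (not sesquilinear) product `a · b` on `ℂ³`. -/
def bdot (a b : EuclideanSpace ℂ (Fin 3)) : ℂ := ∑ i, a i * b i

/-! ### Traces -/

/-- `f` is of class `H¹` in `U` near `Γ`. -/
def MemH1Near (U Γ : Set R3) (f : R3 → ℂ) : Prop :=
  ∃ N : Set R3, IsOpen N ∧ Γ ⊆ N ∧ MemH1 (U ∩ N) f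

/-- `g ∈ L²(Γ)` is the trace on `Γ`, a union of components of the boundary of `U`, of a function `f`
which is `H¹` in `U` near `Γ`: there are smooth functions `φ n` on the whole space which converge to
`f` in `H¹(U ∩ N)`, for a neighbourhood `N` of `Γ`, and whose restrictions to `Γ` converge to `g` in
`L²(Γ)`. -/
def IsTrace (U Γ : Set R3) (f g : R3 → ℂ) : Prop :=
  MemLp g 2 (surfaceMeasure Γ) ∧
  ∃ N : Set R3, IsOpen N ∧ Γ ⊆ N ∧ MemH1 (U ∩ N) f ∧
  ∃ φ : ℕ → R3 → ℂ, (∀ n, ContDiff ℝ ∞ (φ n) ∧ HasCompactSupport (φ n)) ∧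
    Tendsto (fun n => eLpNorm (φ n - f) 2 (volume.restrict (U ∩ N))) atTop (𝓝 0) ∧
    Tendsto (fun n => eLpNorm (classicalGrad (φ n) - weakGrad (U ∩ N) f) 2
      (volume.restrict (U ∩ N))) atTop (𝓝 0) ∧
    Tendsto (fun n => eLpNorm (φ n - g) 2 (surfaceMeasure Γ)) atTop (𝓝 0)

/-- There is a trace operator on `Γ`: every function that is `H¹` in `U` near `Γ` has one and only
one trace. For a compact `Γ` along which the boundary of `U` is Lipschitz this is the classical trace
theorem. -/
def HasTraceOperator (U Γ : Set R3) : Prop :=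
  ∀ f, MemH1Near U Γ f → ∃ g, IsTrace U Γ f g ∧
    ∀ g', IsTrace U Γ f g' → g' =ᵐ[surfaceMeasure Γ] g

open Classical in
/-- The trace operator `f ↦ f|_Γ` (taken from the side of `U`), with values in `L²(Γ)`; by
convention it is zero where there is no trace operator. -/
def trace (U Γ : Set R3) (f : R3 → ℂ) : R3 → ℂ :=
  if h : HasTraceOperator U Γ ∧ ∃ g, IsTrace U Γ f g then h.2.choose else 0

/-! ### Weak solutions -/

/-- `v ∈ H¹(Ω)` is a weak solution of `Δv + V₀ v = 0` in `Ω`. -/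
def IsWeakSolution (Ω : Set R3) (V₀ v : R3 → ℂ) : Prop :=
  MemH1 Ω v ∧
  ∀ ψ, MemH1 Ω ψ → trace Ω (frontier Ω) ψ =ᵐ[surfaceMeasure (frontier Ω)] 0 →
    -(∫ x in Ω, bdot (weakGrad Ω v x) (weakGrad Ω ψ x)) + ∫ x in Ω, V₀ x * v x * ψ x = 0

/-- `u ∈ H¹(Ω ∖ D̄)` is a weak solution of `Δu + V₀ u = 0` in `Ω ∖ D̄`, `∂u/∂ν + lam u = 0` on `∂D`
(`ν` being the unit normal pointing out of `D`) and `u = v` on `∂Ω`. -/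
def IsWeakObstacleSolution (Ω D : Set R3) (V₀ lam v u : R3 → ℂ) : Prop :=
  MemH1 (Ω \ closure D) u ∧
  (∀ φ, MemH1 (Ω \ closure D) φ →
    trace (Ω \ closure D) (frontier Ω) φ =ᵐ[surfaceMeasure (frontier Ω)] 0 →
    (∫ x, lam x * trace (Ω \ closure D) (frontier D) u x * trace (Ω \ closure D) (frontier D) φ x
        ∂(surfaceMeasure (frontier D)))
      - (∫ x in Ω \ closure D,
          bdot (weakGrad (Ω \ closure D) u x) (weakGrad (Ω \ closure D) φ x))
      + ∫ x in Ω \ closure D, V₀ x * u x * φ x = 0) ∧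
  trace (Ω \ closure D) (frontier Ω) u
    =ᵐ[surfaceMeasure (frontier Ω)] trace Ω (frontier Ω) v

/-! ### Normal derivatives on the outer boundary

They are functionals on `H^{1/2}(∂Ω)`, the space of the traces on `∂Ω`, given by the value of a
bilinear form at an arbitrary lifting; the value is independent of the lifting when the function is
a weak solution. Off `H^{1/2}(∂Ω)` they are given the value zero. -/

open Classical in
/-- The pairing `⟨∂v/∂ν|_{∂Ω}, f⟩` for a weak solution `v` of `Δv + V₀ v = 0` in `Ω`. -/
def normalDeriv (Ω : Set R3) (V₀ v f : R3 → ℂ) : ℂ :=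
  if h : ∃ η, MemH1 Ω η ∧ trace Ω (frontier Ω) η =ᵐ[surfaceMeasure (frontier Ω)] f
  then (∫ x in Ω, bdot (weakGrad Ω v x) (weakGrad Ω h.choose x))
    - ∫ x in Ω, V₀ x * v x * h.choose x
  else 0

open Classical in
/-- The pairing `⟨∂u/∂ν|_{∂Ω}, f⟩` for a weak solution `u` of `Δu + V₀ u = 0` in `Ω ∖ D̄` with
`∂u/∂ν + lam u = 0` on `∂D`. -/
def normalDerivObstacle (Ω D : Set R3) (V₀ lam u f : R3 → ℂ) : ℂ :=
  if h : ∃ φ, MemH1 (Ω \ closure D) φ ∧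
      trace (Ω \ closure D) (frontier Ω) φ =ᵐ[surfaceMeasure (frontier Ω)] f
  then -(∫ x, lam x * trace (Ω \ closure D) (frontier D) u x
        * trace (Ω \ closure D) (frontier D) h.choose x ∂(surfaceMeasure (frontier D)))
    + (∫ x in Ω \ closure D,
        bdot (weakGrad (Ω \ closure D) u x) (weakGrad (Ω \ closure D) h.choose x))
    - ∫ x in Ω \ closure D, V₀ x * u x * h.choose x
  else 0

end ObstacleProblem

end

noncomputable section

namespace ObstacleProblem

/-! ### Componentwise conjugation -/

/-! The function `conj v` lifts the boundary datum both in `Ω` and in `U = Ω \ closure D`, so both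
normal derivatives may be evaluated with it (`IsWeakSolution.normalDeriv_eq`,
`IsWeakObstacleSolution.normalDerivObstacle_eq`). Put `u = w + v` and split the integrals over `Ω`
along `D`: the quadratic terms of `v` over `U` cancel, those over `D` and `∂D` survive, and what
remains is the cross term ∫_∂D λ w v̄ - ∫_U ∇w·∇v̄ + ∫_U V₀ w v̄.

Since `w` has zero trace on `∂Ω`, `conj w` is an admissible test function for `u` (`test_conj_sub`).
Conjugating the resulting equation expresses the same cross term, but with conjugated coefficients,
through |w|² and |∇w|². Replacing λ̄ and V̄₀ by λ and V₀ costs 2i times their imaginary parts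
(`integral_mul_mul_conj_swap`).

The rest is support: weak gradients and traces are chosen objects, so restriction, subtraction and
conjugation hold only almost everywhere; and `∂D` must be Lebesgue null for the splitting. -/

/-- Componentwise complex conjugation on `ℂ³`. -/
def conjVec (a : EuclideanSpace ℂ (Fin 3)) : EuclideanSpace ℂ (Fin 3) :=
  WithLp.toLp 2 fun i => conj (a i)

@[simp] lemma conjVec_apply (a : EuclideanSpace ℂ (Fin 3)) (i : Fin 3) :
    conjVec a i = conj (a i) := rfl

lemma norm_conjVec (a : EuclideanSpace ℂ (Fin 3)) : ‖conjVec a‖ = ‖a‖ := by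
  simp [EuclideanSpace.norm_eq]

lemma conjVec_sub (a b : EuclideanSpace ℂ (Fin 3)) :
    conjVec (a - b) = conjVec a - conjVec b := by
  ext i; simp

lemma bdot_add_left (a b c : EuclideanSpace ℂ (Fin 3)) :
    bdot (a + b) c = bdot a c + bdot b c := by
  simp [bdot, add_mul, Finset.sum_add_distrib]

lemma bdot_sub_right (a b c : EuclideanSpace ℂ (Fin 3)) :
    bdot a (b - c) = bdot a b - bdot a c := by
  simp [bdot, mul_sub, Finset.sum_sub_distrib]

/-- Conjugating the second argument turns the bilinear product into the Hermitian one; this is how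
conjugated test functions produce energies. -/
lemma bdot_conjVec_self (a : EuclideanSpace ℂ (Fin 3)) :
    bdot a (conjVec a) = ((‖a‖ ^ 2 : ℝ) : ℂ) := by
  simp [bdot, EuclideanSpace.norm_sq_eq, Complex.mul_conj, Complex.normSq_eq_norm_sq]

lemma conj_bdot_conjVec (a b : EuclideanSpace ℂ (Fin 3)) :
    conj (bdot a (conjVec b)) = bdot b (conjVec a) := by
  simp [bdot, mul_comm]

/-! ### Integrability of products -/

section MemLp

variable {α : Type*} [MeasurableSpace α] {μ : Measure α}

lemma memLp_conj {p : ℝ≥0∞} {f : α → ℂ} (hf : MemLp f p μ) :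
    MemLp (fun x => conj (f x)) p μ :=
  hf.of_le (Complex.continuous_conj.comp_aestronglyMeasurable hf.1) (by simp)

lemma memLp_conjVec {p : ℝ≥0∞} {G : α → EuclideanSpace ℂ (Fin 3)} (hG : MemLp G p μ) :
    MemLp (fun x => conjVec (G x)) p μ :=
  MemLp.of_eval_piLp fun i => memLp_conj (hG.eval_piLp i)

lemma integrable_bdot {F G : α → EuclideanSpace ℂ (Fin 3)} (hF : MemLp F 2 μ)
    (hG : MemLp G 2 μ) : Integrable (fun x => bdot (F x) (G x)) μ :=
  integrable_finsetSum _ fun i _ => (hF.eval_piLp i).integrable_mul (hG.eval_piLp i)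

lemma integrable_mul {f g : α → ℂ} (hf : MemLp f 2 μ) (hg : MemLp g 2 μ) :
    Integrable (fun x => f x * g x) μ :=
  hf.integrable_mul hg

lemma integrable_mul_mul {a f g : α → ℂ} (ha : MemLp a ∞ μ) (hf : MemLp f 2 μ)
    (hg : MemLp g 2 μ) : Integrable (fun x => a x * f x * g x) μ :=
  (MemLp.mul (p := ∞) (r := 2) hf ha).integrable_mul hg

end MemLp

/-! ### Weak gradients -/

section WeakGrad

variable {U U' : Set R3} {f g : R3 → ℂ} {F G : R3 → EuclideanSpace ℂ (Fin 3)}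

/-- A test function supported in `U'` is also one for `U`, and both integrands vanish on `U \ U'`.
-/
lemma IsWeakGrad.mono (hU : IsOpen U) (hUU' : U' ⊆ U) (h : IsWeakGrad U f G) :
    IsWeakGrad U' f G := by
  intro i φ h1 h2 h3
  rw [← setIntegral_eq_of_subset_of_forall_sdiff_eq_zero hU.measurableSet hUU',
    ← setIntegral_eq_of_subset_of_forall_sdiff_eq_zero hU.measurableSet hUU']
  · exact h i φ h1 h2 (h3.trans hUU')
  · intro x hx
    simp [image_eq_zero_of_notMem_tsupport fun hx' => hx.2 (h3 hx')]
  · intro x hx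
    have : x ∉ tsupport (fderiv ℝ φ) := fun hx' => hx.2 (h3 (tsupport_fderiv_subset ℝ hx'))
    simp [image_eq_zero_of_notMem_tsupport this]

lemma memLp_ofReal_of_continuous {φ : R3 → ℝ} {μ : Measure R3} [IsFiniteMeasureOnCompacts μ]
    (h : Continuous φ) (h' : HasCompactSupport φ) : MemLp (fun x => (φ x : ℂ)) 2 μ :=
  (h.memLp_of_hasCompactSupport h').ofReal

lemma memLp_partial {φ : R3 → ℝ} {μ : Measure R3} [IsFiniteMeasureOnCompacts μ]
    (h : ContDiff ℝ ∞ φ) (h' : HasCompactSupport φ) (i : Fin 3) :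
    MemLp (fun x => ((fderiv ℝ φ x (basisVec i) : ℝ) : ℂ)) 2 μ :=
  memLp_ofReal_of_continuous
    ((h.continuous_fderiv (by simp)).clm_apply continuous_const) (h'.fderiv_apply ℝ _)

lemma IsWeakGrad.sub (hf : MemLp f 2 (volume.restrict U)) (hg : MemLp g 2 (volume.restrict U))
    (hF : MemLp F 2 (volume.restrict U)) (hG : MemLp G 2 (volume.restrict U))
    (h : IsWeakGrad U f F) (h' : IsWeakGrad U g G) : IsWeakGrad U (f - g) (F - G) := by
  intro i φ h1 h2 h3
  have e1 := h i φ h1 h2 h3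
  have e2 := h' i φ h1 h2 h3
  have hφ := memLp_ofReal_of_continuous (μ := volume.restrict U) h1.continuous h2
  have hdφ := memLp_partial (μ := volume.restrict U) h1 h2 i
  simp only [Pi.sub_apply, PiLp.sub_apply, sub_mul]
  rw [integral_sub (integrable_mul hf hdφ) (integrable_mul hg hdφ),
    integral_sub (integrable_mul (hF.eval_piLp i) hφ) (integrable_mul (hG.eval_piLp i) hφ),
    e1, e2]
  ring

/-- Test functions are real, so conjugating the defining identity leaves them unchanged. -/
lemma IsWeakGrad.conj (h : IsWeakGrad U f G) :
    IsWeakGrad U (fun x => conj (f x)) (fun x => conjVec (G x)) := by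
  intro i φ h1 h2 h3
  have := congrArg (starRingEnd ℂ) (h i φ h1 h2 h3)
  rw [map_neg, ← integral_conj, ← integral_conj] at this
  simpa using this

/-- The weak gradient is unique almost everywhere. -/
lemma IsWeakGrad.ae_eq (hU : IsOpen U) (hF : MemLp F 2 (volume.restrict U))
    (hG : MemLp G 2 (volume.restrict U)) (h : IsWeakGrad U f F) (h' : IsWeakGrad U f G) :
    F =ᵐ[volume.restrict U] G := by
  have key : ∀ i, ∀ᵐ x, x ∈ U → F x i - G x i = 0 := by
    intro i
    have hd : MemLp (fun x => F x i - G x i) 2 (volume.restrict U) :=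
      (hF.eval_piLp i).sub (hG.eval_piLp i)
    -- Fundamental lemma of the calculus of variations, one component at a time.
    refine hU.ae_eq_zero_of_integral_contDiff_smul_eq_zero
      (locallyIntegrableOn_of_locallyIntegrable_restrict (hd.locallyIntegrable (by simp))) ?_
    intro φ h1 h2 h3
    have hφ := memLp_ofReal_of_continuous (μ := volume.restrict U) h1.continuous h2
    rw [← setIntegral_eq_integral_of_forall_compl_eq_zero (s := U)]
    · have e : ∫ x in U, F x i * (φ x : ℂ) = ∫ x in U, G x i * (φ x : ℂ) :=
        neg_injective ((h i φ h1 h2 h3).symm.trans (h' i φ h1 h2 h3))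
      simp only [Complex.real_smul, mul_comm (φ _ : ℂ), sub_mul]
      rw [integral_sub (integrable_mul (hF.eval_piLp i) hφ)
        (integrable_mul (hG.eval_piLp i) hφ), e, sub_self]
    · intro x hx
      simp [image_eq_zero_of_notMem_tsupport fun hx' => hx (h3 hx')]
  rw [Filter.EventuallyEq, ae_restrict_iff' hU.measurableSet]
  filter_upwards [ae_all_iff.2 key] with x hx hxU
  ext i
  exact sub_eq_zero.1 (hx i hxU)

lemma MemH1.weakGrad_spec (h : MemH1 U f) :
    MemLp (weakGrad U f) 2 (volume.restrict U) ∧ IsWeakGrad U f (weakGrad U f) := by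
  rw [weakGrad, dif_pos h.2]
  exact h.2.choose_spec

lemma MemH1.memLp_weakGrad (h : MemH1 U f) : MemLp (weakGrad U f) 2 (volume.restrict U) :=
  h.weakGrad_spec.1

/-- Frees later arguments from the arbitrary choice in `weakGrad`: exhibiting one square integrable
weak gradient identifies it. -/
lemma weakGrad_ae_eq (hU : IsOpen U) (hG : MemLp G 2 (volume.restrict U))
    (h : IsWeakGrad U f G) : weakGrad U f =ᵐ[volume.restrict U] G := by
  have hex : ∃ G : R3 → EuclideanSpace ℂ (Fin 3),
    MemLp G 2 (volume.restrict U) ∧ IsWeakGrad U f G := ⟨G, hG, h⟩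
  rw [weakGrad, dif_pos hex]
  exact IsWeakGrad.ae_eq hU hex.choose_spec.1 hG hex.choose_spec.2 h

lemma memLp_restrict_mono {E : Type*} [NormedAddCommGroup E] {f : R3 → E} {p : ℝ≥0∞}
    (h : U' ⊆ U) (hf : MemLp f p (volume.restrict U)) : MemLp f p (volume.restrict U') :=
  hf.mono_measure (Measure.restrict_mono_set _ h)

lemma MemH1.mono (hU : IsOpen U) (hUU' : U' ⊆ U) (h : MemH1 U f) : MemH1 U' f :=
  ⟨memLp_restrict_mono hUU' h.1, weakGrad U f, memLp_restrict_mono hUU' h.memLp_weakGrad,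
    h.weakGrad_spec.2.mono hU hUU'⟩

lemma MemH1.weakGrad_mono (hU : IsOpen U) (hU' : IsOpen U') (hUU' : U' ⊆ U) (h : MemH1 U f) :
    weakGrad U' f =ᵐ[volume.restrict U'] weakGrad U f :=
  weakGrad_ae_eq hU' (memLp_restrict_mono hUU' h.memLp_weakGrad) (h.weakGrad_spec.2.mono hU hUU')

lemma MemH1.sub (hf : MemH1 U f) (hg : MemH1 U g) : MemH1 U (f - g) :=
  ⟨hf.1.sub hg.1, _, hf.memLp_weakGrad.sub hg.memLp_weakGrad,
    hf.weakGrad_spec.2.sub hf.1 hg.1 hf.memLp_weakGrad hg.memLp_weakGrad hg.weakGrad_spec.2⟩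

lemma MemH1.weakGrad_sub (hU : IsOpen U) (hf : MemH1 U f) (hg : MemH1 U g) :
    weakGrad U (f - g) =ᵐ[volume.restrict U] weakGrad U f - weakGrad U g :=
  weakGrad_ae_eq hU (hf.memLp_weakGrad.sub hg.memLp_weakGrad)
    (hf.weakGrad_spec.2.sub hf.1 hg.1 hf.memLp_weakGrad hg.memLp_weakGrad hg.weakGrad_spec.2)

lemma MemH1.conj (hf : MemH1 U f) : MemH1 U (fun x => conj (f x)) :=
  ⟨memLp_conj hf.1, _, memLp_conjVec hf.memLp_weakGrad, hf.weakGrad_spec.2.conj⟩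

lemma MemH1.weakGrad_conj (hU : IsOpen U) (hf : MemH1 U f) :
    weakGrad U (fun x => conj (f x)) =ᵐ[volume.restrict U] fun x => conjVec (weakGrad U f x) :=
  weakGrad_ae_eq hU (memLp_conjVec hf.memLp_weakGrad) hf.weakGrad_spec.2.conj

end WeakGrad

/-! ### Classical gradients -/

section ClassicalGrad

variable {φ ψ : R3 → ℂ}

lemma classicalGrad_sub (hφ : ContDiff ℝ ∞ φ) (hψ : ContDiff ℝ ∞ ψ) :
    classicalGrad (φ - ψ) = classicalGrad φ - classicalGrad ψ := by
  funext x
  ext i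
  simp only [classicalGrad, Pi.sub_apply, PiLp.sub_apply]
  rw [fderiv_sub (hφ.differentiable (by simp) x) (hψ.differentiable (by simp) x)]
  rfl

/-- Conjugation is a real-linear isomorphism, hence commutes with `fderiv ℝ` even where `φ` is not
differentiable. -/
lemma classicalGrad_conj (φ : R3 → ℂ) :
    classicalGrad (fun x => conj (φ x)) = fun x => conjVec (classicalGrad φ x) := by
  funext x
  ext i
  have := Complex.conjCLE.comp_fderiv (f := φ) (x := x)
  exact congrArg (fun L => L (basisVec i)) this

lemma continuous_classicalGrad (hφ : ContDiff ℝ ∞ φ) : Continuous (classicalGrad φ) :=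
  (PiLp.continuous_toLp 2 _).comp <| continuous_pi fun _ =>
    (hφ.continuous_fderiv (by simp)).clm_apply continuous_const

end ClassicalGrad

/-! ### Traces -/

section Trace

variable {U U' Γ N : Set R3} {f g f' g' : R3 → ℂ}

lemma tendsto_eLpNorm_sub {α E : Type*} [MeasurableSpace α] [NormedAddCommGroup E]
    {μ : Measure α} {a b : ℕ → α → E} {s t : α → E}
    (ha : ∀ n, AEStronglyMeasurable (a n) μ) (hb : ∀ n, AEStronglyMeasurable (b n) μ)
    (hs : AEStronglyMeasurable s μ) (ht : AEStronglyMeasurable t μ)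
    (h : Tendsto (fun n => eLpNorm (a n - s) 2 μ) atTop (𝓝 0))
    (h' : Tendsto (fun n => eLpNorm (b n - t) 2 μ) atTop (𝓝 0)) :
    Tendsto (fun n => eLpNorm ((a n - b n) - (s - t)) 2 μ) atTop (𝓝 0) := by
  refine tendsto_of_tendsto_of_tendsto_of_le_of_le tendsto_const_nhds
    (by simpa using h.add h') (fun _ => zero_le) fun n => ?_
  rw [sub_sub_sub_comm]
  exact eLpNorm_sub_le ((ha n).sub hs) ((hb n).sub ht) (by simp)

/-- The neighbourhood in the definition of a trace can be shrunk. -/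
lemma IsTrace.exists_approx (hU : IsOpen U) (h : IsTrace U Γ f g) :
    ∃ N : Set R3, IsOpen N ∧ Γ ⊆ N ∧ ∀ N' ⊆ N, IsOpen N' → MemH1 (U ∩ N') f ∧
    ∃ φ : ℕ → R3 → ℂ, (∀ n, ContDiff ℝ ∞ (φ n) ∧ HasCompactSupport (φ n)) ∧
    Tendsto (fun n => eLpNorm (φ n - f) 2 (volume.restrict (U ∩ N'))) atTop (𝓝 0) ∧
    Tendsto (fun n => eLpNorm (classicalGrad (φ n) - weakGrad (U ∩ N') f) 2
      (volume.restrict (U ∩ N'))) atTop (𝓝 0) ∧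
    Tendsto (fun n => eLpNorm (φ n - g) 2 (surfaceMeasure Γ)) atTop (𝓝 0) := by
  obtain ⟨-, N, hN, hΓN, hf, φ, hφ, h1, h2, h3⟩ := h
  refine ⟨N, hN, hΓN, fun N' hN'N hN' => ?_⟩
  have hsub : U ∩ N' ⊆ U ∩ N := inter_subset_inter_right U hN'N
  have hle : volume.restrict (U ∩ N') ≤ volume.restrict (U ∩ N) :=
    Measure.restrict_mono_set _ hsub
  refine ⟨hf.mono (hU.inter hN) hsub, φ, hφ, ?_, ?_, h3⟩
  · exact tendsto_of_tendsto_of_tendsto_of_le_of_le tendsto_const_nhds h1 (fun _ => zero_le)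
      fun n => eLpNorm_mono_measure _ hle
  · refine tendsto_of_tendsto_of_tendsto_of_le_of_le tendsto_const_nhds h2 (fun _ => zero_le)
      fun n => ?_
    -- The gradients on the two sets are chosen independently; they agree only almost everywhere on
    -- the smaller set.
    have := hf.weakGrad_mono (hU.inter hN) (hU.inter hN') hsub
    rw [eLpNorm_congr_ae (this.mono fun x hx => by
      rw [Pi.sub_apply, hx, ← Pi.sub_apply (f := classicalGrad (φ n)) (g := weakGrad (U ∩ N) f)])]
    exact eLpNorm_mono_measure _ hle

/-- Traces depend only on the set near `Γ`. -/
lemma IsTrace.congr_set (hU : IsOpen U) (hN : IsOpen N) (hΓN : Γ ⊆ N) (hUN : U ∩ N = U' ∩ N)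
    (h : IsTrace U Γ f g) : IsTrace U' Γ f g := by
  obtain ⟨M, hM, hΓM, H⟩ := h.exists_approx hU
  have e : U ∩ (M ∩ N) = U' ∩ (M ∩ N) := by
    rw [inter_comm M, ← inter_assoc, hUN, inter_assoc]
  refine ⟨h.1, M ∩ N, hM.inter hN, subset_inter hΓM hΓN, ?_⟩
  rw [← e]
  exact H _ inter_subset_left (hM.inter hN)

lemma MemH1Near.congr_set (hU : IsOpen U) (hN : IsOpen N) (hΓN : Γ ⊆ N)
    (hUN : U ∩ N = U' ∩ N) (h : MemH1Near U Γ f) : MemH1Near U' Γ f := by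
  obtain ⟨M, hM, hΓM, H⟩ := h
  have e : U ∩ (M ∩ N) = U' ∩ (M ∩ N) := by
    rw [inter_comm M, ← inter_assoc, hUN, inter_assoc]
  refine ⟨M ∩ N, hM.inter hN, subset_inter hΓM hΓN, ?_⟩
  rw [← e]
  exact H.mono (hU.inter hM) (inter_subset_inter_right U inter_subset_left)

/-- Existence is carried from `U` to `U'`, while uniqueness pulls competing traces back from `U'` to
`U`. -/
lemma HasTraceOperator.congr_set (hU : IsOpen U) (hU' : IsOpen U') (hN : IsOpen N)
    (hΓN : Γ ⊆ N) (hUN : U ∩ N = U' ∩ N) (h : HasTraceOperator U Γ) :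
    HasTraceOperator U' Γ := by
  intro f hf
  obtain ⟨g, hg, huniq⟩ := h f (hf.congr_set hU' hN hΓN hUN.symm)
  exact ⟨g, hg.congr_set hU hN hΓN hUN,
    fun g' hg' => huniq g' (hg'.congr_set hU' hN hΓN hUN.symm)⟩

lemma IsTrace.sub (hU : IsOpen U) (h : IsTrace U Γ f g) (h' : IsTrace U Γ f' g') :
    IsTrace U Γ (f - f') (g - g') := by
  obtain ⟨M, hM, hΓM, H⟩ := h.exists_approx hU
  obtain ⟨M', hM', hΓM', H'⟩ := h'.exists_approx hU
  -- Each trace comes with its own neighbourhood; both approximations are moved to the intersection.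
  have hO := hM.inter hM'
  obtain ⟨hf, φ, hφ, h1, h2, h3⟩ := H _ inter_subset_left hO
  obtain ⟨hf', φ', hφ', h1', h2', h3'⟩ := H' _ inter_subset_right hO
  have hc : ∀ n, Continuous (φ n) := fun n => (hφ n).1.continuous
  have hc' : ∀ n, Continuous (φ' n) := fun n => (hφ' n).1.continuous
  refine ⟨h.1.sub h'.1, M ∩ M', hO, subset_inter hΓM hΓM', hf.sub hf', fun n => φ n - φ' n,
    fun n => ⟨(hφ n).1.sub (hφ' n).1, (hφ n).2.sub (hφ' n).2⟩, ?_, ?_, ?_⟩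
  · exact tendsto_eLpNorm_sub (fun n => (hc n).aestronglyMeasurable)
      (fun n => (hc' n).aestronglyMeasurable) hf.1.1 hf'.1.1 h1 h1'
  · refine (tendsto_eLpNorm_sub
      (fun n => (continuous_classicalGrad (hφ n).1).aestronglyMeasurable)
      (fun n => (continuous_classicalGrad (hφ' n).1).aestronglyMeasurable)
      hf.memLp_weakGrad.1 hf'.memLp_weakGrad.1 h2 h2').congr fun n => eLpNorm_congr_ae ?_
    rw [classicalGrad_sub (hφ n).1 (hφ' n).1]
    filter_upwards [hf.weakGrad_sub (hU.inter hO) hf'] with x hx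
    simp only [Pi.sub_apply, hx]
  · exact tendsto_eLpNorm_sub (fun n => (hc n).aestronglyMeasurable)
      (fun n => (hc' n).aestronglyMeasurable) h.1.1 h'.1.1 h3 h3'

lemma IsTrace.conj (hU : IsOpen U) (h : IsTrace U Γ f g) :
    IsTrace U Γ (fun x => conj (f x)) (fun x => conj (g x)) := by
  obtain ⟨hg, N, hN, hΓN, hf, φ, hφ, h1, h2, h3⟩ := h
  refine ⟨memLp_conj hg, N, hN, hΓN, hf.conj, fun n x => conj (φ n x),
    fun n => ⟨Complex.conjCLE.contDiff.comp (hφ n).1,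
      (hφ n).2.comp_left (g := starRingEnd ℂ) (map_zero _)⟩,
    h1.congr fun n => eLpNorm_congr_norm_ae ?_, h2.congr fun n => eLpNorm_congr_norm_ae ?_,
    h3.congr fun n => eLpNorm_congr_norm_ae ?_⟩
  · filter_upwards with x
    simp only [Pi.sub_apply, ← map_sub, RCLike.norm_conj]
  · filter_upwards [hf.weakGrad_conj (hU.inter hN)] with x hx
    rw [Pi.sub_apply, Pi.sub_apply, hx, classicalGrad_conj, ← conjVec_sub, norm_conjVec]
  · filter_upwards with x
    simp only [Pi.sub_apply, ← map_sub, RCLike.norm_conj]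

lemma MemH1.near (h : MemH1 U f) (Γ : Set R3) : MemH1Near U Γ f :=
  ⟨univ, isOpen_univ, subset_univ _, by rwa [inter_univ]⟩

lemma HasTraceOperator.isTrace (hT : HasTraceOperator U Γ) (hf : MemH1Near U Γ f) :
    IsTrace U Γ f (trace U Γ f) := by
  have h : HasTraceOperator U Γ ∧ ∃ g, IsTrace U Γ f g :=
    ⟨hT, (hT f hf).imp fun _ hg => hg.1⟩
  rw [trace, dif_pos h]
  exact h.2.choose_spec

lemma HasTraceOperator.trace_ae_eq (hT : HasTraceOperator U Γ) (h : IsTrace U Γ f g) :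
    trace U Γ f =ᵐ[surfaceMeasure Γ] g := by
  have hf : MemH1Near U Γ f := by
    obtain ⟨-, N, hN, hΓN, hf, -⟩ := h
    exact ⟨N, hN, hΓN, hf⟩
  obtain ⟨g₀, -, huniq⟩ := hT f hf
  exact (huniq _ (hT.isTrace hf)).trans (huniq _ h).symm

/-- With this default value the rules below for subtraction, conjugation and change of set hold
trivially when there is no trace operator, so the trace theorem need not be proved. -/
lemma trace_eq_zero (hT : ¬ HasTraceOperator U Γ) (f : R3 → ℂ) : trace U Γ f = 0 := by
  rw [trace, dif_neg fun h => hT h.1]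

lemma MemH1.memLp_trace (hf : MemH1 U f) : MemLp (trace U Γ f) 2 (surfaceMeasure Γ) := by
  by_cases hT : HasTraceOperator U Γ
  · exact (hT.isTrace (hf.near Γ)).1
  · rw [trace_eq_zero hT]
    exact MemLp.zero

lemma MemH1.trace_sub (hU : IsOpen U) (hf : MemH1 U f) (hg : MemH1 U g) :
    trace U Γ (f - g) =ᵐ[surfaceMeasure Γ] trace U Γ f - trace U Γ g := by
  by_cases hT : HasTraceOperator U Γ
  · exact hT.trace_ae_eq ((hT.isTrace (hf.near Γ)).sub hU (hT.isTrace (hg.near Γ)))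
  · simp [trace_eq_zero hT]

lemma MemH1.trace_conj (hU : IsOpen U) (hf : MemH1 U f) :
    trace U Γ (fun x => conj (f x)) =ᵐ[surfaceMeasure Γ] fun x => conj (trace U Γ f x) := by
  by_cases hT : HasTraceOperator U Γ
  · exact hT.trace_ae_eq ((hT.isTrace (hf.near Γ)).conj hU)
  · simp only [trace_eq_zero hT, Pi.zero_apply, map_zero]
    rfl

lemma MemH1.trace_congr_set (hU : IsOpen U) (hU' : IsOpen U') (hN : IsOpen N)
    (hΓN : Γ ⊆ N) (hUN : U ∩ N = U' ∩ N) (hf : MemH1 U f) :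
    trace U Γ f =ᵐ[surfaceMeasure Γ] trace U' Γ f := by
  by_cases hT : HasTraceOperator U Γ
  · have hT' := hT.congr_set hU hU' hN hΓN hUN
    exact (hT'.trace_ae_eq ((hT.isTrace (hf.near Γ)).congr_set hU hN hΓN hUN)).symm
  · have hT' : ¬ HasTraceOperator U' Γ :=
      fun h => hT (h.congr_set hU' hU hN hΓN hUN.symm)
    rw [trace_eq_zero hT, trace_eq_zero hT']

end Trace

/-! ### Lipschitz boundaries are null sets -/

/-- Dimension below 3 kills the three-dimensional Hausdorff measure, and Lebesgue measure is
absolutely continuous with respect to it. -/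
lemma volume_eq_zero_of_dimH_le_two {s : Set R3} (hs : dimH s ≤ 2) : volume s = 0 := by
  have hac : (volume : Measure R3) ≪ Measure.hausdorffMeasure (Module.finrank ℝ R3 : ℝ) :=
    Measure.absolutelyContinuous_isAddHaarMeasure _ _
  rw [finrank_euclideanSpace_fin] at hac
  refine measure_zero_of_dimH_lt (d := 3) (by exact_mod_cast hac) (hs.trans_lt ?_)
  norm_num

/-- The graph of a Lipschitz function of two variables is at most two-dimensional. -/
lemma dimH_lipschitz_graph_le {K : NNReal} {g : EuclideanSpace ℝ (Fin 2) → ℝ}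
    (hg : LipschitzWith K g) : dimH {y : R3 | y 2 = g !₂[y 0, y 1]} ≤ 2 := by
  let F : EuclideanSpace ℝ (Fin 2) → R3 := fun p => !₂[p 0, p 1, g p]
  -- The sharp constant is √(1 + K²); the cruder 1 + K avoids the root, and the slack in the squares
  -- is 2K·dist².
  have hF : LipschitzWith (Real.toNNReal (1 + K)) F := by
    refine LipschitzWith.of_dist_le' fun p q => ?_
    have h1 : dist (g p) (g q) ≤ K * dist p q := hg.dist_le_mul p q
    have e1 : dist (F p) (F q) ^ 2 = dist p q ^ 2 + dist (g p) (g q) ^ 2 := by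
      rw [EuclideanSpace.dist_sq_eq, EuclideanSpace.dist_sq_eq]
      simp [F, Fin.sum_univ_three, Fin.sum_univ_two]
    refine abs_le_of_sq_le_sq' ?_ (by positivity) |>.2
    have h2 : dist (g p) (g q) ^ 2 ≤ (K * dist p q) ^ 2 := by gcongr
    have h3 : 0 ≤ (K : ℝ) * dist p q ^ 2 := by positivity
    nlinarith
  have hsub : {y : R3 | y 2 = g !₂[y 0, y 1]} ⊆ range F := by
    intro y hy
    refine ⟨!₂[y 0, y 1], ?_⟩
    ext i
    fin_cases i
    · rfl
    · rfl
    · exact hy.symm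
  refine (dimH_mono hsub).trans (hF.dimH_range_le.trans ?_)
  rw [Real.dimH_univ_eq_finrank, finrank_euclideanSpace_fin]
  rfl

lemma continuous_firstTwo :
    Continuous fun y : R3 => (!₂[y 0, y 1] : EuclideanSpace ℝ (Fin 2)) := by
  refine (PiLp.continuous_toLp 2 _).comp (continuous_pi fun i => ?_)
  fin_cases i
  · exact (EuclideanSpace.proj (𝕜 := ℝ) (0 : Fin 3)).continuous
  · exact (EuclideanSpace.proj (𝕜 := ℝ) (1 : Fin 3)).continuous

/-- Locally, points strictly below the graph are interior and points strictly above are exterior, so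
the frontier lies in an isometric copy of a Lipschitz graph. -/
lemma HasLipschitzBoundary.volume_frontier {U : Set R3} (h : HasLipschitzBoundary U) :
    volume (frontier U) = 0 := by
  refine measure_null_of_locally_null _ fun x hx => ?_
  obtain ⟨e, g, r, ⟨K, hg⟩, hr, hxy⟩ := h x hx
  have hball := Metric.ball_mem_nhds x hr
  refine ⟨frontier U ∩ Metric.ball x r, inter_mem_nhdsWithin _ hball, ?_⟩
  have hc : Continuous fun y : R3 => g !₂[(e y) 0, (e y) 1] := by
    exact hg.continuous.comp (continuous_firstTwo.comp e.continuous)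
  have hc2 : Continuous fun y : R3 => (e y) 2 :=
    (EuclideanSpace.proj (𝕜 := ℝ) (2 : Fin 3)).continuous.comp e.continuous
  have hsub : frontier U ∩ Metric.ball x r ⊆ e ⁻¹' {y : R3 | y 2 = g !₂[y 0, y 1]} := by
    rintro y ⟨hyU, hy⟩
    have hnear : ∀ᶠ z in 𝓝 y, z ∈ Metric.ball x r := Metric.isOpen_ball.mem_nhds hy
    rcases lt_trichotomy ((e y) 2) (g !₂[(e y) 0, (e y) 1]) with hlt | heq | hgt
    · refine absurd (mem_interior_iff_mem_nhds.2 ?_) hyU.2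
      filter_upwards [hnear, hc2.continuousAt.eventually_lt hc.continuousAt hlt] with z hz hz'
      exact (hxy z hz).2 hz'
    · exact heq
    · refine absurd ?_ (mem_closure_iff_frequently.1 hyU.1)
      filter_upwards [hnear, hc.continuousAt.eventually_lt hc2.continuousAt hgt] with z hz hz' hzU
      exact lt_asymm hz' ((hxy z hz).1 hzU)
  refine measure_mono_null hsub ?_
  refine volume_eq_zero_of_dimH_le_two ?_
  exact (e.toIsometryEquiv.dimH_preimage _).trans_le (dimH_lipschitz_graph_le hg)

/-! ### Normal derivatives computed with a given lifting -/

section NormalDeriv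

variable {Ω D U : Set R3} {V₀ lam v u η f g : R3 → ℂ}

lemma MemH1.integral_bdot_sub (hU : IsOpen U) (hu : MemH1 U u) (hf : MemH1 U f)
    (hg : MemH1 U g) :
    ∫ x in U, bdot (weakGrad U u x) (weakGrad U (f - g) x)
      = (∫ x in U, bdot (weakGrad U u x) (weakGrad U f x))
        - ∫ x in U, bdot (weakGrad U u x) (weakGrad U g x) := by
  rw [← integral_sub (integrable_bdot hu.memLp_weakGrad hf.memLp_weakGrad)
    (integrable_bdot hu.memLp_weakGrad hg.memLp_weakGrad)]
  refine integral_congr_ae ?_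
  filter_upwards [hf.weakGrad_sub hU hg] with x hx
  rw [hx, Pi.sub_apply, bdot_sub_right]

lemma integral_mul_mul_sub {α : Type*} [MeasurableSpace α] {μ : Measure α} {a h f g : α → ℂ}
    (ha : MemLp a ∞ μ) (hh : MemLp h 2 μ) (hf : MemLp f 2 μ) (hg : MemLp g 2 μ) :
    ∫ x, a x * h x * (f - g) x ∂μ
      = (∫ x, a x * h x * f x ∂μ) - ∫ x, a x * h x * g x ∂μ := by
  rw [← integral_sub (integrable_mul_mul ha hh hf) (integrable_mul_mul ha hh hg)]
  simp only [Pi.sub_apply, mul_sub]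

/-- The normal derivative of a weak solution can be computed with any lifting. -/
lemma IsWeakSolution.normalDeriv_eq (hΩ : IsOpen Ω) (hV₀ : MemLp V₀ ∞ (volume.restrict Ω))
    (hv : IsWeakSolution Ω V₀ v) (hη : MemH1 Ω η)
    (hηf : trace Ω (frontier Ω) η =ᵐ[surfaceMeasure (frontier Ω)] f) :
    normalDeriv Ω V₀ v f
      = (∫ x in Ω, bdot (weakGrad Ω v x) (weakGrad Ω η x)) - ∫ x in Ω, V₀ x * v x * η x := by
  have h : ∃ η, MemH1 Ω η ∧ trace Ω (frontier Ω) η =ᵐ[surfaceMeasure (frontier Ω)] f :=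
    ⟨η, hη, hηf⟩
  rw [normalDeriv, dif_pos h]
  obtain ⟨hχ, hχf⟩ := h.choose_spec
  generalize h.choose = χ at hχ hχf
  -- `χ` is the lifting picked by the definition. Its difference from `η` has zero trace, so the
  -- weak equation applies to it.
  have hz : trace Ω (frontier Ω) (χ - η) =ᵐ[surfaceMeasure (frontier Ω)] 0 := by
    filter_upwards [hχ.trace_sub (Γ := frontier Ω) hΩ hη, hχf, hηf] with x h1 h2 h3
    rw [h1, Pi.sub_apply, h2, h3, sub_self, Pi.zero_apply]
  have key := hv.2 _ (hχ.sub hη) hz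
  rw [hv.1.integral_bdot_sub hΩ hχ hη, integral_mul_mul_sub hV₀ hv.1.1 hχ.1 hη.1] at key
  linear_combination -key

/-- The normal derivative of a weak solution of the obstacle problem can be computed with any
lifting. -/
lemma IsWeakObstacleSolution.normalDerivObstacle_eq (hU : IsOpen (Ω \ closure D))
    (hV₀ : MemLp V₀ ∞ (volume.restrict (Ω \ closure D)))
    (hlam : MemLp lam ∞ (surfaceMeasure (frontier D)))
    (hu : IsWeakObstacleSolution Ω D V₀ lam v u) (hη : MemH1 (Ω \ closure D) η)
    (hηf : trace (Ω \ closure D) (frontier Ω) η =ᵐ[surfaceMeasure (frontier Ω)] f) :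
    normalDerivObstacle Ω D V₀ lam u f
      = -(∫ x, lam x * trace (Ω \ closure D) (frontier D) u x
          * trace (Ω \ closure D) (frontier D) η x ∂(surfaceMeasure (frontier D)))
        + (∫ x in Ω \ closure D,
            bdot (weakGrad (Ω \ closure D) u x) (weakGrad (Ω \ closure D) η x))
        - ∫ x in Ω \ closure D, V₀ x * u x * η x := by
  have h : ∃ η, MemH1 (Ω \ closure D) η ∧
      trace (Ω \ closure D) (frontier Ω) η =ᵐ[surfaceMeasure (frontier Ω)] f := ⟨η, hη, hηf⟩
  rw [normalDerivObstacle, dif_pos h]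
  obtain ⟨hχ, hχf⟩ := h.choose_spec
  generalize h.choose = χ at hχ hχf
  have hz : trace (Ω \ closure D) (frontier Ω) (χ - η) =ᵐ[surfaceMeasure (frontier Ω)] 0 := by
    filter_upwards [hχ.trace_sub (Γ := frontier Ω) hU hη, hχf, hηf] with x h1 h2 h3
    rw [h1, Pi.sub_apply, h2, h3, sub_self, Pi.zero_apply]
  have key := hu.2.1 _ (hχ.sub hη) hz
  have hγ : ∫ x, lam x * trace (Ω \ closure D) (frontier D) u x
        * trace (Ω \ closure D) (frontier D) (χ - η) x ∂(surfaceMeasure (frontier D))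
      = ∫ x, lam x * trace (Ω \ closure D) (frontier D) u x
        * (trace (Ω \ closure D) (frontier D) χ - trace (Ω \ closure D) (frontier D) η) x
          ∂(surfaceMeasure (frontier D)) := by
    refine integral_congr_ae ?_
    filter_upwards [hχ.trace_sub (Γ := frontier D) hU hη] with x hx
    rw [hx]
  rw [hγ, hu.1.integral_bdot_sub hU hχ hη, integral_mul_mul_sub hV₀ hu.1.1 hχ.1 hη.1,
    integral_mul_mul_sub hlam hu.1.memLp_trace hχ.memLp_trace hη.memLp_trace] at key
  linear_combination -key

end NormalDeriv

/-! ### Sesquilinear identities -/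

section Sesquilinear

variable {α : Type*} [MeasurableSpace α] {μ : Measure α}

lemma integral_mul_mul_conj_self (a f : α → ℂ) :
    ∫ x, a x * f x * conj (f x) ∂μ = ∫ x, a x * ((‖f x‖ ^ 2 : ℝ) : ℂ) ∂μ := by
  refine integral_congr_ae (Eventually.of_forall fun x => ?_)
  simp [mul_assoc, Complex.mul_conj, Complex.normSq_eq_norm_sq]

lemma integral_bdot_conjVec_self (F : α → EuclideanSpace ℂ (Fin 3)) :
    ∫ x, bdot (F x) (conjVec (F x)) ∂μ = ((∫ x, ‖F x‖ ^ 2 ∂μ : ℝ) : ℂ) := by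
  rw [← integral_complex_ofReal]
  simp only [bdot_conjVec_self]

lemma conj_integral_bdot_conjVec (F G : α → EuclideanSpace ℂ (Fin 3)) :
    conj (∫ x, bdot (F x) (conjVec (G x)) ∂μ) = ∫ x, bdot (G x) (conjVec (F x)) ∂μ := by
  rw [← integral_conj]
  simp only [conj_bdot_conjVec]

lemma conj_integral_mul_norm_sq (a f : α → ℂ) :
    conj (∫ x, a x * ((‖f x‖ ^ 2 : ℝ) : ℂ) ∂μ)
      = ∫ x, conj (a x) * ((‖f x‖ ^ 2 : ℝ) : ℂ) ∂μ := by
  rw [← integral_conj]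
  simp only [map_mul, Complex.conj_ofReal]

/-- Exchanging the roles of the two functions in a weighted `L²` pairing costs the imaginary part
of the weight. -/
lemma integral_mul_mul_conj_swap {a f g : α → ℂ} (ha : MemLp a ∞ μ) (hf : MemLp f 2 μ)
    (hg : MemLp g 2 μ) :
    ∫ x, a x * f x * conj (g x) ∂μ
      = conj (∫ x, a x * g x * conj (f x) ∂μ)
        + 2 * Complex.I * ∫ x, ((a x).im : ℂ) * f x * conj (g x) ∂μ := by
  have him : MemLp (fun x => ((a x).im : ℂ)) ∞ μ := ha.im.ofReal
  rw [← integral_conj, ← integral_const_mul, ← integral_add]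
  · refine integral_congr_ae (Eventually.of_forall fun x => ?_)
    have := Complex.sub_conj (a x)
    push_cast at this
    simp only [map_mul, Complex.conj_conj]
    -- Pointwise this is a - ā = 2i Im a.
    linear_combination f x * conj (g x) * this
  · simpa only [map_mul, Complex.conj_conj, mul_right_comm] using
      integrable_mul_mul (memLp_conj ha) hf (memLp_conj hg)
  · exact (integrable_mul_mul him hf (memLp_conj hg)).const_mul _

lemma integral_mul_add_mul {a f g h : α → ℂ} (ha : MemLp a ∞ μ) (hf : MemLp f 2 μ)
    (hg : MemLp g 2 μ) (hh : MemLp h 2 μ) :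
    ∫ x, a x * (f x + g x) * h x ∂μ
      = (∫ x, a x * f x * h x ∂μ) + ∫ x, a x * g x * h x ∂μ := by
  rw [← integral_add (integrable_mul_mul ha hf hh) (integrable_mul_mul ha hg hh)]
  simp only [mul_add, add_mul]

lemma integral_bdot_add_left {F G H : α → EuclideanSpace ℂ (Fin 3)} (hF : MemLp F 2 μ)
    (hG : MemLp G 2 μ) (hH : MemLp H 2 μ) :
    ∫ x, bdot (F x + G x) (H x) ∂μ = (∫ x, bdot (F x) (H x) ∂μ) + ∫ x, bdot (G x) (H x) ∂μ := by
  rw [← integral_add (integrable_bdot hF hH) (integrable_bdot hG hH)]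
  simp only [bdot_add_left]

end Sesquilinear

/-! ### Splitting integrals along the obstacle -/

/-- The natural splitting is along `closure D`, which differs from `D` only inside the null set
`frontier D`. -/
lemma integral_eq_add_of_obstacle {Ω D : Set R3} (hDΩ : closure D ⊆ Ω)
    (hnull : volume (frontier D) = 0) {f : R3 → ℂ}
    (hf : Integrable f (volume.restrict Ω)) :
    ∫ x in Ω, f x = (∫ x in D, f x) + ∫ x in Ω \ closure D, f x := by
  rw [← integral_inter_add_sdiff (isClosed_closure (s := D)).measurableSet hf,
    inter_eq_self_of_subset_right hDΩ]
  congr 1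
  refine setIntegral_congr_set ?_
  rw [closure_eq_self_union_frontier]
  exact union_ae_eq_left_of_ae_eq_empty (ae_eq_empty.2 hnull)

/-- The weak formulation of the obstacle problem, tested with the conjugate of the scattered part
`u - v`. -/
lemma IsWeakObstacleSolution.test_conj_sub {Ω D : Set R3} {V₀ lam v u : R3 → ℂ}
    (hU : IsOpen (Ω \ closure D)) (hu : IsWeakObstacleSolution Ω D V₀ lam v u)
    (hv : MemH1 (Ω \ closure D) v)
    (htr : trace Ω (frontier Ω) v =ᵐ[surfaceMeasure (frontier Ω)]
      trace (Ω \ closure D) (frontier Ω) v) :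
    (∫ x, lam x * trace (Ω \ closure D) (frontier D) u x
        * conj (trace (Ω \ closure D) (frontier D) (u - v) x) ∂(surfaceMeasure (frontier D)))
      - (∫ x in Ω \ closure D, bdot (weakGrad (Ω \ closure D) u x)
          (conjVec (weakGrad (Ω \ closure D) (u - v) x)))
      + ∫ x in Ω \ closure D, V₀ x * u x * conj ((u - v) x) = 0 := by
  have hw := hu.1.sub hv
  have hz : trace (Ω \ closure D) (frontier Ω) (fun x => conj ((u - v) x))
      =ᵐ[surfaceMeasure (frontier Ω)] 0 := by
    filter_upwards [hw.trace_conj (Γ := frontier Ω) hU, hu.1.trace_sub (Γ := frontier Ω) hU hv,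
      hu.2.2, htr] with x h1 h2 h3 h4
    rw [h1, h2, Pi.sub_apply, h3, h4, sub_self, map_zero, Pi.zero_apply]
  rw [← hu.2.1 _ hw.conj hz]
  congr 2
  · refine integral_congr_ae ?_
    filter_upwards [hw.trace_conj (Γ := frontier D) hU] with x hx
    rw [hx]
  · refine integral_congr_ae ?_
    filter_upwards [hw.weakGrad_conj hU] with x hx
    rw [hx]

end ObstacleProblem

end

/-! ### The energy identity -/

theorem proposition1p1
    (Ω D : Set ObstacleProblem.R3) (V₀ lam v u w : ObstacleProblem.R3 → ℂ)
    (hΩ_open : IsOpen Ω) (hΩ_conn : IsConnected Ω) (hΩ_bdd : Bornology.IsBounded Ω)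
    (hΩ_smooth : ObstacleProblem.HasSmoothBoundary Ω)
    (hD_open : IsOpen D) (hD_nonempty : D.Nonempty) (hD_sub : closure D ⊆ Ω)
    (hD_conn : IsConnected (Ω \ closure D))
    (hD_lip : ObstacleProblem.HasLipschitzBoundary D)
    (hV₀ : MemLp V₀ ∞ (volume.restrict Ω))
    (hlam : MemLp lam ∞ (ObstacleProblem.surfaceMeasure (frontier D)))
    (hv : ObstacleProblem.IsWeakSolution Ω V₀ v)
    (hu : ObstacleProblem.IsWeakObstacleSolution Ω D V₀ lam v u)
    (hw : w = u - v) :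
    let U := Ω \ closure D
    let dS := ObstacleProblem.surfaceMeasure (frontier D)
    let γv := ObstacleProblem.trace U (frontier D) v
    let γw := ObstacleProblem.trace U (frontier D) w
    let vbar : ObstacleProblem.R3 → ℂ :=
      fun x => conj (ObstacleProblem.trace Ω (frontier Ω) v x)
    ObstacleProblem.normalDeriv Ω V₀ v vbar
        - ObstacleProblem.normalDerivObstacle Ω D V₀ lam u vbar
      = 2 * Complex.I * (∫ x, ((lam x).im : ℂ) * γw x * conj (γv x) ∂dS)
        + 2 * Complex.I * (∫ x in U, ((V₀ x).im : ℂ) * w x * conj (v x))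
        - (∫ x, conj (lam x) * ((‖γw x‖ ^ 2 : ℝ) : ℂ) ∂dS)
        + ((∫ x in U, ‖ObstacleProblem.weakGrad U w x‖ ^ 2 : ℝ) : ℂ)
        - (∫ x in U, conj (V₀ x) * ((‖w x‖ ^ 2 : ℝ) : ℂ))
        + (∫ x, lam x * ((‖γv x‖ ^ 2 : ℝ) : ℂ) ∂dS)
        + ((∫ x in D, ‖ObstacleProblem.weakGrad Ω v x‖ ^ 2 : ℝ) : ℂ)
        - (∫ x in D, V₀ x * ((‖v x‖ ^ 2 : ℝ) : ℂ)) := by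
  open ObstacleProblem in
  intro U dS γv γw vbar
  have hU : IsOpen U := hΩ_open.sdiff isClosed_closure
  have hUΩ : U ⊆ Ω := sdiff_subset
  have hvU : MemH1 U v := hv.1.mono hΩ_open hUΩ
  have hwU : MemH1 U w := hw ▸ hu.1.sub hvU
  have hV₀U : MemLp V₀ ∞ (volume.restrict U) := memLp_restrict_mono hUΩ hV₀
  have hγv : MemLp γv 2 dS := hvU.memLp_trace
  have hγw : MemLp γw 2 dS := hwU.memLp_trace
  have hGv := hvU.memLp_weakGrad
  have hGw := hwU.memLp_weakGrad
  -- the traces of `v` on the outer boundary, taken in `Ω` and in `U`, agree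
  have htr : trace Ω (frontier Ω) v =ᵐ[surfaceMeasure (frontier Ω)] trace U (frontier Ω) v := by
    -- The complement of `closure D` is a neighbourhood of `∂Ω` on which `Ω` and `U` coincide.
    refine hv.1.trace_congr_set hΩ_open hU (N := (closure D)ᶜ) isClosed_closure.isOpen_compl
      (fun x hx hxD => hx.2 (hΩ_open.interior_eq.symm ▸ hD_sub hxD)) ?_
    ext x
    simp [U]
  -- `u = w + v`
  have huw : ∀ x, u x = w x + v x := fun x => by simp [hw]
  have hγu : trace U (frontier D) u =ᵐ[dS] fun x => γw x + γv x := by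
    filter_upwards [hu.1.trace_sub (Γ := frontier D) hU hvU] with x hx
    simp only [γw, hw, hx, Pi.sub_apply, γv, sub_add_cancel]
  have hGu : weakGrad U u =ᵐ[volume.restrict U] fun x => weakGrad U w x + weakGrad U v x := by
    filter_upwards [hu.1.weakGrad_sub hU hvU] with x hx
    simp only [hw, hx, Pi.sub_apply, sub_add_cancel]
  have splitS : ∀ h : R3 → ℂ, MemLp h 2 dS → ∫ x, lam x * trace U (frontier D) u x * h x ∂dS
      = (∫ x, lam x * γw x * h x ∂dS) + ∫ x, lam x * γv x * h x ∂dS := fun h hh => by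
    rw [← integral_mul_add_mul hlam hγw hγv hh]
    exact integral_congr_ae (hγu.mono fun x hx => by simp only [hx])
  have splitV : ∀ h : R3 → ℂ, MemLp h 2 (volume.restrict U) → ∫ x in U, V₀ x * u x * h x
      = (∫ x in U, V₀ x * w x * h x) + ∫ x in U, V₀ x * v x * h x := fun h hh => by
    rw [← integral_mul_add_mul hV₀U hwU.1 hvU.1 hh]
    simp only [huw]
  have splitG : ∀ H : R3 → EuclideanSpace ℂ (Fin 3), MemLp H 2 (volume.restrict U) →
      ∫ x in U, bdot (weakGrad U u x) (H x)
      = (∫ x in U, bdot (weakGrad U w x) (H x)) + ∫ x in U, bdot (weakGrad U v x) (H x) :=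
    fun H hH => by
      rw [← integral_bdot_add_left hGw hGv hH]
      exact integral_congr_ae (hGu.mono fun x hx => by simp only [hx])
  -- the normal derivatives, computed with the lifting `conj v`
  have hN := hv.normalDeriv_eq hΩ_open hV₀ hv.1.conj (hv.1.trace_conj hΩ_open)
  have hlift : trace U (frontier Ω) (fun x => conj (v x))
      =ᵐ[surfaceMeasure (frontier Ω)] vbar := by
    filter_upwards [hvU.trace_conj (Γ := frontier Ω) hU, htr] with x h1 h2
    simp only [h1, vbar, h2]
  have hM := hu.normalDerivObstacle_eq hU hV₀U hlam hvU.conj hlift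
  have e1 : ∫ x in Ω, bdot (weakGrad Ω v x) (weakGrad Ω (fun x => conj (v x)) x)
      = ∫ x in Ω, bdot (weakGrad Ω v x) (conjVec (weakGrad Ω v x)) :=
    integral_congr_ae ((hv.1.weakGrad_conj hΩ_open).mono fun x hx => by simp only [hx])
  have e2 : ∫ x in U, bdot (weakGrad U u x) (weakGrad U (fun x => conj (v x)) x)
      = ∫ x in U, bdot (weakGrad U u x) (conjVec (weakGrad U v x)) :=
    integral_congr_ae ((hvU.weakGrad_conj hU).mono fun x hx => by simp only [hx])
  have e3 : ∫ x, lam x * trace U (frontier D) u x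
        * trace U (frontier D) (fun x => conj (v x)) x ∂dS
      = ∫ x, lam x * trace U (frontier D) u x * conj (γv x) ∂dS :=
    integral_congr_ae
      ((hvU.trace_conj (Γ := frontier D) hU).mono fun x hx => by simp only [hx, γv])
  -- the integrals over `Ω` split along the obstacle
  have hnull := hD_lip.volume_frontier
  have s1 := integral_eq_add_of_obstacle hD_sub hnull
    (integrable_bdot hv.1.memLp_weakGrad (memLp_conjVec hv.1.memLp_weakGrad))
  have s2 := integral_eq_add_of_obstacle hD_sub hnull
    (integrable_mul_mul hV₀ hv.1.1 (memLp_conj hv.1.1))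
  have s3 : ∫ x in U, bdot (weakGrad Ω v x) (conjVec (weakGrad Ω v x))
      = ∫ x in U, bdot (weakGrad U v x) (conjVec (weakGrad U v x)) :=
    integral_congr_ae ((hv.1.weakGrad_mono hΩ_open hU hUΩ).mono fun x hx => by simp only [hx])
  -- the weak formulation tested with `conj w`, conjugated
  have key := hu.test_conj_sub hU hvU htr
  rw [← hw] at key
  change (∫ x, lam x * trace U (frontier D) u x * conj (γw x) ∂dS)
      - (∫ x in U, bdot (weakGrad U u x) (conjVec (weakGrad U w x)))
      + ∫ x in U, V₀ x * u x * conj (w x) = 0 at key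
  rw [splitS _ (memLp_conj hγw), splitG _ (memLp_conjVec hGw), splitV _ (memLp_conj hwU.1),
    integral_mul_mul_conj_self, integral_bdot_conjVec_self, integral_mul_mul_conj_self] at key
  -- The tested equation pairs `v` with `conj w`, the normal derivatives pair `w` with `conj v`;
  -- conjugation matches them and puts the bars on λ and V₀.
  have keyc := congrArg (starRingEnd ℂ) key
  simp only [map_add, map_sub, map_zero, conj_integral_mul_norm_sq, conj_integral_bdot_conjVec,
    Complex.conj_ofReal] at keyc
  have hS := integral_mul_mul_conj_swap hlam hγw hγv
  have hV := integral_mul_mul_conj_swap hV₀U hwU.1 hvU.1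
  rw [splitS _ (memLp_conj hγv), integral_mul_mul_conj_self lam γv] at e3
  rw [splitG _ (memLp_conjVec hGv)] at e2
  have e4 := splitV _ (memLp_conj hvU.1)
  rw [integral_bdot_conjVec_self (μ := volume.restrict D), s3] at s1
  rw [integral_mul_mul_conj_self (μ := volume.restrict D)] at s2
  rw [hN, e1, s1, s2]
  rw [hM]
  -- `e3`, `e2`, `e4` expand the obstacle pairing; `hS` and `hV` exchange the coefficients of the
  -- cross term for their conjugates; `keyc` then eliminates it.
  linear_combination e3 - e2 + e4 + hS + hV + keyc
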